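/- A signing of $n\times n$ matrices is an $n\times n$ matrix $s$ with entries in $\{\pm 1\}$; for a real $n\times n$ matrix $M$, the signed matrix $M(s)$ is the entry-wise product of $M$ and $s$. There exists a polynomial-time algorithm that, given a bipartite graph $G$ (finite and simple) with adjacency matrix $A_G$, decides whether there is a symmetric signing $s$ such that $A_G(s)$ is singular, and, if there is one, outputs such a signing. -/

import Mathlib

/-!
A random access machine, presented as while programs over natural-number registers and arrays,
with an explicit count of elementary steps; signings of matrices; and the encodings of graphs and
of answers as bit strings.
-/

namespace RAM

/-- A memory: registers `var x`, and arrays `arr a` whose cells are `arr a i`.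
All of them hold natural numbers. -/
@[ext]
structure State where
  var : ℕ → ℕ
  arr : ℕ → ℕ → ℕ

/-- Expressions: constants, registers, sums, truncated differences, and array cells `a[e]`.
There is no multiplication, so that `t` steps lengthen the binary expansions of the
stored numbers by `O(t)` bits only, and charging one step per operation is polynomially equivalent
to Turing machine time. -/
inductive Exp where
  | const (c : ℕ)
  | var (x : ℕ)
  | add (e f : Exp)
  | sub (e f : Exp)
  | load (a : ℕ) (e : Exp)

namespace Exp

/-- The value of an expression in a given memory. -/
def eval (σ : State) : Exp → ℕ
  | const c => c
  | var x => σ.var x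
  | add e f => e.eval σ + f.eval σ
  | sub e f => e.eval σ - f.eval σ
  | load a e => σ.arr a (e.eval σ)

/-- The number of elementary operations performed when an expression is evaluated. -/
def cost : Exp → ℕ
  | const _ => 1
  | var _ => 1
  | add e f => e.cost + f.cost + 1
  | sub e f => e.cost + f.cost + 1
  | load _ e => e.cost + 1

end Exp

/-- Programs. A test `e` succeeds when the value of `e` is not zero. -/
inductive Prog where
  /-- `x := e` -/
  | assign (x : ℕ) (e : Exp)
  /-- `a[e] := f` -/
  | store (a : ℕ) (e f : Exp)
  /-- first `P`, then `Q` -/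
  | seq (P Q : Prog)
  /-- `P` if the test `e` succeeds, `Q` otherwise -/
  | cond (e : Exp) (P Q : Prog)
  /-- repeat `P` as long as the test `e` succeeds -/
  | loop (e : Exp) (P : Prog)

/-- `Exec P σ τ t`: started in the memory `σ`, the program `P` halts in the memory `τ` after
exactly `t` elementary steps. -/
inductive Exec : Prog → State → State → ℕ → Prop
  | assign (x : ℕ) (e : Exp) (σ : State) :
      Exec (.assign x e) σ ⟨Function.update σ.var x (e.eval σ), σ.arr⟩ (e.cost + 1)
  | store (a : ℕ) (e f : Exp) (σ : State) :
      Exec (.store a e f) σ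
        ⟨σ.var, Function.update σ.arr a (Function.update (σ.arr a) (e.eval σ) (f.eval σ))⟩
        (e.cost + f.cost + 1)
  | seq {P Q : Prog} {σ τ ρ : State} {t u : ℕ} :
      Exec P σ τ t → Exec Q τ ρ u → Exec (.seq P Q) σ ρ (t + u)
  | cond_true {e : Exp} {P Q : Prog} {σ τ : State} {t : ℕ} :
      e.eval σ ≠ 0 → Exec P σ τ t → Exec (.cond e P Q) σ τ (e.cost + 1 + t)
  | cond_false {e : Exp} {P Q : Prog} {σ τ : State} {t : ℕ} :
      e.eval σ = 0 → Exec Q σ τ t → Exec (.cond e P Q) σ τ (e.cost + 1 + t)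
  | loop_done {e : Exp} {P : Prog} {σ : State} :
      e.eval σ = 0 → Exec (.loop e P) σ σ (e.cost + 1)
  | loop_again {e : Exp} {P : Prog} {σ τ ρ : State} {t u : ℕ} :
      e.eval σ ≠ 0 → Exec P σ τ t → Exec (.loop e P) τ ρ u →
        Exec (.loop e P) σ ρ (e.cost + 1 + t + u)

/-- The initial memory on the input word `w`: register `0` holds the length of `w`, array `0` holds
the bits of `w`, and everything else is zero. -/
def State.init (w : List Bool) : State where
  var x := if x = 0 then w.length else 0
  arr a i := if a = 0 then (w.getD i false).toNat else 0

/-- The memory `τ` presents the output word `v`: register `1` holds the length of `v`, and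
array `1` holds the bits of `v`. -/
def State.Presents (τ : State) (v : List Bool) : Prop :=
  τ.var 1 = v.length ∧ ∀ (i : ℕ) (hi : i < v.length), τ.arr 1 i = (v[i]).toNat

/-- On the input word `w`, the program `P` halts after at most `T` elementary steps, with the
output word `v`. -/
def Prog.OutputsWithin (P : Prog) (w v : List Bool) (T : ℕ) : Prop :=
  ∃ (τ : State) (t : ℕ), Exec P (State.init w) τ t ∧ t ≤ T ∧ τ.Presents v

end RAM

/-- A signing of `n × n` matrices: a matrix with entries `±1` (the units of `ℤ`). -/
abbrev Signing (n : ℕ) : Type := Matrix (Fin n) (Fin n) ℤˣ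

/-- The signed matrix `M(s)`: the entry-wise product of `M` and the signing `s`. -/
def signedMatrix {n : ℕ} (M : Matrix (Fin n) (Fin n) ℝ) (s : Signing n) :
    Matrix (Fin n) (Fin n) ℝ :=
  Matrix.of fun i j => M i j * ((s i j : ℤ) : ℝ)

/-- The `n * n` bits `b i j`, listed row by row. -/
def rowMajor {n : ℕ} (b : Fin n → Fin n → Bool) : List Bool :=
  List.ofFn fun k : Fin (n * n) => b k.divNat k.modNat

/-- A graph on `n` vertices as a bit string: the entries of its adjacency matrix, row by row. -/
def encodeGraph {n : ℕ} (G : SimpleGraph (Fin n)) [DecidableRel G.Adj] : List Bool :=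
  rowMajor fun i j => decide (G.Adj i j)

/-- An answer as a bit string: the bit `0` for the answer "there is none", and for a signing the
bit `1`, followed by the entries of the signing row by row (bit `1` for `+1`, bit `0` for `-1`). -/
def encodeAnswer {n : ℕ} : Option (Signing n) → List Bool
  | none => [false]
  | some s => true :: rowMajor fun i j => decide (s i j = 1)

/-! Singularity of some signing is decided by the determinant of `A_G` over the field with two
elements. Since `1` and `-1` agree modulo `2`, every signing of `A_G` has a determinant congruent to
`det A_G`. If that is odd, no signing, symmetric or not, is singular (`det_signedMatrix_ne_zero`).

Otherwise some nonempty set of rows adds up to zero modulo `2`, so every column meets the set in an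
even number of ones. Giving these ones alternating signs makes the selected rows add up to zero over
the reals (`sum_alternatingBit`, `det_signedMatrix_eq_zero`). Symmetry could fail only if an entry
and its mirror image both lay in selected rows. Bipartiteness prevents this when the selected rows
have one colour, for then a neighbour of a selected vertex is not selected, and the mirror entry is
free. Gaussian elimination yields such a set by itself: a row is reduced by another only if both are
nonzero in a common pivot column, which forces the two row indices to have the same colour
(`RowCombination.add`).

The algorithm is incremental elimination modulo `2` that records the coefficients of each
combination (`run_eliminate`), followed by writing the alternating signs (`run_writeAnswer`). It is
written in a language of bounded loops, where halting and a polynomial time bound follow from the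
syntax (`exec_compile`), so that only the final memory needs an argument. -/

namespace RAM

/-! ### Bounded-loop programs: semantics, translation and running time -/

/-- The memory after the assignment `x := v`. -/
def State.setVar (σ : State) (x v : ℕ) : State := ⟨Function.update σ.var x v, σ.arr⟩

/-- The memory after the assignment `a[i] := v`. -/
def State.setArr (σ : State) (a i v : ℕ) : State :=
  ⟨σ.var, Function.update σ.arr a (Function.update (σ.arr a) i v)⟩

theorem State.setVar_var (σ : State) (x v y : ℕ) :
    (σ.setVar x v).var y = if y = x then v else σ.var y := by
  simp [State.setVar, Function.update_apply]

@[simp] theorem State.setVar_arr (σ : State) (x v : ℕ) : (σ.setVar x v).arr = σ.arr := rfl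

@[simp] theorem State.setArr_var (σ : State) (a i v : ℕ) : (σ.setArr a i v).var = σ.var := rfl

theorem State.setArr_arr (σ : State) (a i v b j : ℕ) :
    (σ.setArr a i v).arr b j = if b = a ∧ j = i then v else σ.arr b j := by
  by_cases hb : b = a
  · subst hb; simp [State.setArr, Function.update_apply]
  · simp [State.setArr, hb]

/-- Programs all of whose loops run a fixed number of times, given by a bounding register. -/
inductive Cmd where
  | skip
  | assign (x : ℕ) (e : Exp)
  | store (a : ℕ) (e f : Exp)
  | seq (c d : Cmd)
  | ite (e : Exp) (c d : Cmd)
  /-- run `c` for all values of `x` below the bounding register -/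
  | iter (x : ℕ) (c : Cmd)

namespace Cmd

/-- The memory in which a bounded program halts; `b` is the bounding register. -/
def run (b : ℕ) : Cmd → State → State
  | skip, σ => σ
  | assign x e, σ => σ.setVar x (e.eval σ)
  | store a e f, σ => σ.setArr a (e.eval σ) (f.eval σ)
  | seq c d, σ => d.run b (c.run b σ)
  | ite e c d, σ => if e.eval σ = 0 then d.run b σ else c.run b σ
  | iter x c, σ => Nat.rec (σ.setVar x 0) (fun k τ => (c.run b τ).setVar x (k + 1)) (σ.var b)

/-- The translation of bounded programs into programs. -/
def compile (b : ℕ) : Cmd → Prog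
  | skip => .assign 0 (.var 0)
  | assign x e => .assign x e
  | store a e f => .store a e f
  | seq c d => .seq (c.compile b) (d.compile b)
  | ite e c d => .cond e (c.compile b) (d.compile b)
  | iter x c => .seq (.assign x (.const 0))
      (.loop (.sub (.var b) (.var x))
        (.seq (c.compile b) (.assign x (.add (.var x) (.const 1)))))

/-- The registers that a bounded program may write. -/
def vars : Cmd → List ℕ
  | skip => []
  | assign x _ => [x]
  | store _ _ _ => []
  | seq c d => c.vars ++ d.vars
  | ite _ c d => c.vars ++ d.vars
  | iter x c => x :: c.vars

/-- The arrays that a bounded program may write. -/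
def arrs : Cmd → List ℕ
  | skip => []
  | assign _ _ => []
  | store a _ _ => [a]
  | seq c d => c.arrs ++ d.arrs
  | ite _ c d => c.arrs ++ d.arrs
  | iter _ c => c.arrs

/-- Loops do not write their counters. -/
def WellFormed : Cmd → Prop
  | skip => True
  | assign _ _ => True
  | store _ _ _ => True
  | seq c d => c.WellFormed ∧ d.WellFormed
  | ite _ c d => c.WellFormed ∧ d.WellFormed
  | iter x c => x ∉ c.vars ∧ c.WellFormed

/-- A bound on the number of steps, in terms of the bounding register. -/
noncomputable def time : Cmd → Polynomial ℕ
  | skip => 2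
  | assign _ e => (e.cost + 1 : ℕ)
  | store _ e f => (e.cost + f.cost + 1 : ℕ)
  | seq c d => c.time + d.time
  | ite e c d => (e.cost + 1 : ℕ) + c.time + d.time
  | iter _ c => Polynomial.X * (c.time + 8) + 6

/-- With `run_arr`, this is the frame rule. The lists `vars` and `arrs` are read off the syntax, so
for a concrete program and index the hypothesis is settled by `decide`. -/
theorem run_var {b y : ℕ} : ∀ {c : Cmd} {σ : State}, y ∉ c.vars → (c.run b σ).var y = σ.var y
  | skip, _, _ => rfl
  | assign x e, σ, h => by
    simp only [vars, List.mem_singleton] at h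
    simp [run, State.setVar_var, h]
  | store _ _ _, _, _ => rfl
  | seq c d, σ, h => by
    simp only [vars, List.mem_append, not_or] at h
    rw [run, run_var h.2, run_var h.1]
  | ite e c d, σ, h => by
    simp only [vars, List.mem_append, not_or] at h
    rw [run]
    split_ifs
    · exact run_var h.2
    · exact run_var h.1
  | iter x c, σ, h => by
    simp only [vars, List.mem_cons, not_or] at h
    rw [run]
    induction σ.var b with
    | zero => simp [State.setVar_var, h.1]
    | succ k ih => simpa [State.setVar_var, h.1, run_var h.2] using ih

theorem run_arr {b a : ℕ} : ∀ {c : Cmd} {σ : State}, a ∉ c.arrs → (c.run b σ).arr a = σ.arr a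
  | skip, _, _ => rfl
  | assign x e, σ, h => rfl
  | store a' _ _, _, h => by
    simp only [arrs, List.mem_singleton] at h
    simp [run, State.setArr, h]
  | seq c d, σ, h => by
    simp only [arrs, List.mem_append, not_or] at h
    rw [run, run_arr h.2, run_arr h.1]
  | ite e c d, σ, h => by
    simp only [arrs, List.mem_append, not_or] at h
    rw [run]
    split_ifs
    · exact run_arr h.2
    · exact run_arr h.1
  | iter x c, σ, h => by
    simp only [arrs] at h
    rw [run]
    induction σ.var b with
    | zero => rfl
    | succ k ih => simpa [run_arr h] using ih

/-- The invariant rule for bounded loops. -/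
theorem run_iter_induction {b x : ℕ} {c : Cmd} {σ : State} (I : ℕ → State → Prop)
    (zero : I 0 (σ.setVar x 0))
    (succ : ∀ k < σ.var b, ∀ τ : State, τ.var x = k →
      (∀ y ∉ (iter x c).vars, τ.var y = σ.var y) →
      (∀ a ∉ (iter x c).arrs, τ.arr a = σ.arr a) →
      I k τ → I (k + 1) ((c.run b τ).setVar x (k + 1))) :
    I (σ.var b) ((iter x c).run b σ) := by
  rw [run]
  suffices h : ∀ n ≤ σ.var b, ∀ τ : State,
      τ = Nat.rec (σ.setVar x 0) (fun k τ => (c.run b τ).setVar x (k + 1)) n →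
      τ.var x = n ∧ (∀ y ∉ (iter x c).vars, τ.var y = σ.var y) ∧
      (∀ a ∉ (iter x c).arrs, τ.arr a = σ.arr a) ∧ I n τ from (h _ le_rfl _ rfl).2.2.2
  intro n
  induction n with
  | zero =>
    rintro - τ rfl
    refine ⟨by simp [State.setVar_var], fun y hy => ?_, fun a _ => rfl, zero⟩
    simp only [vars, List.mem_cons, not_or] at hy
    simp [State.setVar_var, hy.1]
  | succ n ih =>
    rintro hn τ rfl
    obtain ⟨h1, h2, h3, h4⟩ := ih (by omega) _ rfl
    refine ⟨by simp [State.setVar_var], fun y hy => ?_, fun a ha => ?_,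
      succ n hn _ h1 h2 h3 h4⟩
    · rw [← h2 y hy]
      simp only [vars, List.mem_cons, not_or] at hy
      simp [State.setVar_var, hy.1, run_var hy.2]
    · rw [← h3 a ha]
      exact run_arr (c := c) ha

/-- The translation of a bounded program computes its final memory in polynomial time. -/
theorem exec_compile {b : ℕ} : ∀ {c : Cmd} {σ : State}, c.WellFormed → b ∉ c.vars →
    ∃ t ≤ c.time.eval (σ.var b), Exec (c.compile b) σ (c.run b σ) t
  | skip, σ, _, _ => by
    refine ⟨2, by simp [time], ?_⟩
    have := Exec.assign 0 (.var 0) σ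
    simpa [Exp.eval, Exp.cost, compile, run] using this
  | assign x e, σ, _, _ => ⟨_, by simp [time], Exec.assign x e σ⟩
  | store a e f, σ, _, _ => ⟨_, by simp [time], Exec.store a e f σ⟩
  | seq c d, σ, hw, hb => by
    simp only [vars, List.mem_append, not_or] at hb
    obtain ⟨t, ht, h⟩ := exec_compile (σ := σ) hw.1 hb.1
    obtain ⟨u, hu, h'⟩ := exec_compile (σ := c.run b σ) hw.2 hb.2
    -- The first part leaves the bounding register alone, so both time polynomials are evaluated at
    -- the same number.
    rw [run_var hb.1] at hu
    exact ⟨_, by simpa [time] using add_le_add ht hu, h.seq h'⟩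
  | ite e c d, σ, hw, hb => by
    simp only [vars, List.mem_append, not_or] at hb
    by_cases he : e.eval σ = 0
    · obtain ⟨t, ht, h⟩ := exec_compile (σ := σ) hw.2 hb.2
      refine ⟨_, ?_, by simpa [run, he, compile] using Exec.cond_false he h⟩
      simp only [time, Polynomial.eval_add, Polynomial.eval_natCast, Nat.cast_id]
      omega
    · obtain ⟨t, ht, h⟩ := exec_compile (σ := σ) hw.1 hb.1
      refine ⟨_, ?_, by simpa [run, he, compile] using Exec.cond_true he h⟩
      simp only [time, Polynomial.eval_add, Polynomial.eval_natCast, Nat.cast_id]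
      omega
  | iter x c, σ, hw, hb => by
    simp only [vars, List.mem_cons, not_or] at hb
    set F : ℕ → State := fun n =>
      Nat.rec (σ.setVar x 0) (fun k τ => (c.run b τ).setVar x (k + 1)) n with hF
    have hFx : ∀ k, (F k).var x = k := fun k => by cases k <;> simp [hF, State.setVar_var]
    have hFb : ∀ k, (F k).var b = σ.var b := fun k => by
      induction k with
      | zero => simp [hF, State.setVar_var, hb.1]
      | succ k ih =>
        rw [← ih]
        simp [hF, State.setVar_var, hb.1, run_var hb.2]
    set N := σ.var b with hN
    -- Each round pays 4 for the test and 4 for the increment, besides the body; the last, failing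
    -- test pays the final 4.
    have key : ∀ m k, k + m = N → ∃ t ≤ m * (c.time.eval N + 8) + 4,
        Exec (.loop (.sub (.var b) (.var x))
          (.seq (c.compile b) (.assign x (.add (.var x) (.const 1))))) (F k) (F N) t := by
      intro m
      induction m with
      | zero =>
        rintro k rfl
        refine ⟨4, by simp, Exec.loop_done ?_⟩
        simp [Exp.eval, hFx, hFb]
      | succ m ih =>
        intro k hk
        obtain ⟨u, hu, hloop⟩ := ih (k + 1) (by omega)
        obtain ⟨t, ht, hbody⟩ := exec_compile (σ := F k) hw.2 hb.2
        rw [hFb] at ht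
        have hstep := Exec.assign x (.add (.var x) (.const 1)) (c.run b (F k))
        have hst : (⟨Function.update (c.run b (F k)).var x
            (Exp.eval (c.run b (F k)) (.add (.var x) (.const 1))), (c.run b (F k)).arr⟩ : State) =
            F (k + 1) := by
          simp only [Exp.eval, run_var hw.1, hFx]
          rfl
        rw [hst] at hstep
        refine ⟨_, ?_, Exec.loop_again ?_ (hbody.seq hstep) hloop⟩
        · simp only [Exp.cost]
          rw [Nat.succ_mul]
          omega
        · simp only [Exp.eval, hFx, hFb]
          omega
    obtain ⟨t, ht, h⟩ := key N 0 (by omega)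
    refine ⟨_, ?_, (Exec.assign x (.const 0) σ).seq h⟩
    simp only [time, Exp.cost, Polynomial.eval_add, Polynomial.eval_mul, Polynomial.eval_X,
      Polynomial.eval_ofNat]
    omega

end Cmd

end RAM

/-! ### Elimination modulo 2 that respects a two-colouring -/

/-- `W` is a row with entries `0`, `1`, obtained modulo `2` by adding up the rows `j ≤ i` of the
`N × N` matrix `a` with `D j = 1`, the last of which is row `i`. Moreover this combination respects
the two-colouring `f` of the indices. -/
structure RowCombination (f : ℕ → Bool) (a : ℕ → ℕ → ℕ) (N i : ℕ) (W D : ℕ → ℕ) : Prop where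
  row_le : ∀ l < N, W l ≤ 1
  coeff_le : ∀ l < N, D l ≤ 1
  row_eq : ∀ l < N, (W l : ZMod 2) = ∑ j ∈ Finset.range N, (D j : ZMod 2) * a j l
  coeff_self : D i = 1
  coeff_later : ∀ j < N, i < j → D j = 0
  color_row : ∀ l < N, W l ≠ 0 → f l ≠ f i
  color_coeff : ∀ l < N, D l ≠ 0 → f l = f i

/-- One of the two truncated differences vanishes and the other is the distance of `x` and `y`,
whose sign is irrelevant modulo `2`. The machine adds bits modulo `2` in this form. -/
theorem Nat.cast_dist_zmod_two (x y : ℕ) : ((x - y + (y - x) : ℕ) : ZMod 2) = x + y := by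
  rcases le_total x y with h | h
  · obtain ⟨z, rfl⟩ := Nat.exists_eq_add_of_le h
    have : (x + (x + z : ZMod 2)) = z := by
      rw [← add_assoc, CharTwo.add_self_eq_zero, zero_add]
    simp [this]
  · obtain ⟨z, rfl⟩ := Nat.exists_eq_add_of_le h
    have : (y + z + y : ZMod 2) = z := by
      rw [add_right_comm, CharTwo.add_self_eq_zero, zero_add]
    simp [this]

namespace RowCombination

variable {f : ℕ → Bool} {a : ℕ → ℕ → ℕ} {N i k p : ℕ} {W D W' D' W'' D'' : ℕ → ℕ}

theorem congr (h : RowCombination f a N i W D) (hi : i < N) (hW : ∀ l < N, W' l = W l)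
    (hD : ∀ l < N, D' l = D l) : RowCombination f a N i W' D' where
  row_le l hl := by rw [hW l hl]; exact h.row_le l hl
  coeff_le l hl := by rw [hD l hl]; exact h.coeff_le l hl
  row_eq l hl := by
    rw [hW l hl, h.row_eq l hl]
    exact Finset.sum_congr rfl fun j hj => by rw [hD j (Finset.mem_range.1 hj)]
  coeff_self := by rw [hD i hi, h.coeff_self]
  coeff_later j hj hij := by rw [hD j hj, h.coeff_later j hj hij]
  color_row l hl := by rw [hW l hl]; exact h.color_row l hl
  color_coeff l hl := by rw [hD l hl]; exact h.color_coeff l hl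

theorem self (hi : i < N) (ha : ∀ l < N, a i l ≤ 1) (hf : ∀ l < N, a i l ≠ 0 → f l ≠ f i)
    (hW : ∀ l < N, W l = a i l) (hD : ∀ l < N, D l = if l = i then 1 else 0) :
    RowCombination f a N i W D where
  row_le l hl := by rw [hW l hl]; exact ha l hl
  coeff_le l hl := by rw [hD l hl]; split_ifs <;> simp
  row_eq l hl := by
    rw [hW l hl, Finset.sum_eq_single_of_mem i (Finset.mem_range.2 hi)]
    · simp [hD i hi]
    · intro j hj hji
      simp [hD j (Finset.mem_range.1 hj), hji]
  coeff_self := by simp [hD i hi]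
  coeff_later j hj hij := by simp [hD j hj, hij.ne']
  color_row l hl := by rw [hW l hl]; exact hf l hl
  color_coeff l hl h := by
    rw [hD l hl] at h
    by_cases hli : l = i
    · rw [hli]
    · simp [hli] at h

/-- The shared nonzero column `p` is what keeps the combination monochromatic. As `k < i`, row `i`
does not occur in the second combination, so its coefficient stays `1`. -/
theorem add (h : RowCombination f a N i W D) (h' : RowCombination f a N k W' D') (hk : k < i)
    (hi : i < N) (hp : p < N) (hWp : W p ≠ 0) (hWp' : W' p ≠ 0)
    (hW : ∀ l < N, W'' l = W l - W' l + (W' l - W l))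
    (hD : ∀ l < N, D'' l = D l - D' l + (D' l - D l)) : RowCombination f a N i W'' D'' := by
  -- Both colours differ from that of `p`, and there are only two colours.
  have hf : f k = f i := by
    have h1 := h.color_row p hp hWp
    have h2 := h'.color_row p hp hWp'
    revert h1 h2
    cases f p <;> cases f k <;> cases f i <;> simp
  refine ⟨fun l hl => ?_, fun l hl => ?_, fun l hl => ?_, ?_, fun j hj hij => ?_,
    fun l hl hl' => ?_, fun l hl hl' => ?_⟩
  · have := h.row_le l hl
    have := h'.row_le l hl
    rw [hW l hl]; omega
  · have := h.coeff_le l hl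
    have := h'.coeff_le l hl
    rw [hD l hl]; omega
  · rw [hW l hl, Nat.cast_dist_zmod_two, h.row_eq l hl, h'.row_eq l hl, ← Finset.sum_add_distrib]
    refine Finset.sum_congr rfl fun j hj => ?_
    rw [hD j (Finset.mem_range.1 hj), Nat.cast_dist_zmod_two, add_mul]
  · rw [hD i hi, h.coeff_self, h'.coeff_later i hi hk]
  · rw [hD j hj, h.coeff_later j hj hij, h'.coeff_later j hj (hk.trans hij)]
  · rw [hW l hl] at hl'
    by_cases h0 : W l = 0
    · rw [← hf]
      exact h'.color_row l hl (by omega)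
    · exact h.color_row l hl h0
  · rw [hD l hl] at hl'
    by_cases h0 : D l = 0
    · rw [← hf]
      exact h'.color_coeff l hl (by omega)
    · exact h.color_coeff l hl h0

end RowCombination

/-- If the rows can be combined, in a unitriangular way, to a matrix that is lower triangular
up to the choice of a column for each row, then the matrix is invertible modulo `2`. -/
theorem det_ne_zero_of_rowCombination {f : ℕ → Bool} {a : ℕ → ℕ → ℕ} {N : ℕ} {R C : ℕ → ℕ → ℕ}
    {P : ℕ → ℕ} (h : ∀ k < N, RowCombination f a N k (R k) (C k)) (hP : ∀ k < N, P k < N)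
    (hdiag : ∀ k < N, R k (P k) ≠ 0) (htri : ∀ k k', k < k' → k' < N → R k' (P k) = 0) :
    (Matrix.of fun i j : Fin N => (a i j : ZMod 2)).det ≠ 0 := by
  set A := Matrix.of fun i j : Fin N => (a i j : ZMod 2)
  set Q := Matrix.of fun j k : Fin N => if (j : ℕ) = P k then (1 : ZMod 2) else 0
  set C' := Matrix.of fun i j : Fin N => (C i j : ZMod 2)
  have hCA : C' * A = Matrix.of fun i j : Fin N => (R i j : ZMod 2) := by
    ext i l
    simp only [Matrix.mul_apply, C', A, Matrix.of_apply]
    rw [(h i i.2).row_eq l l.2, Finset.sum_range]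
  have hprod : C' * A * Q = Matrix.of fun i k : Fin N => (R i (P k) : ZMod 2) := by
    rw [hCA]
    ext i k
    simp only [Matrix.mul_apply, Q, Matrix.of_apply]
    rw [Finset.sum_eq_single (⟨P k, hP k k.2⟩ : Fin N)]
    · simp
    · intro j _ hj
      have : (j : ℕ) ≠ P k := fun hh => hj (Fin.ext hh)
      simp [this]
    · simp
  -- The product has the pivots, all equal to `1`, on the diagonal and zeros below it. Determinant
  -- `1` for the product already excludes determinant `0` for the factor `A`; nothing is needed
  -- about `C'` and `Q`.
  have hdet : (C' * A * Q).det = 1 := by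
    rw [hprod, Matrix.det_of_isUpperTriangular]
    · refine Finset.prod_eq_one fun k _ => ?_
      have h1 := (h k k.2).row_le (P k) (hP k k.2)
      have h2 := hdiag k k.2
      have : R k (P k) = 1 := by omega
      simp [this]
    · intro i k hik
      simp [htri k i hik i.2]
  intro h0
  rw [Matrix.det_mul, Matrix.det_mul, h0] at hdet
  simp at hdet

/-! ### Alternating signs -/

/-- The number of selected neighbours of `w` below `u`, modulo `2`. -/
def alternatingBit (a : ℕ → ℕ → ℕ) (E : ℕ → ℕ) (u w : ℕ) : ℕ :=
  (∑ x ∈ Finset.range u, if E x ≠ 0 ∧ a x w ≠ 0 then 1 else 0) % 2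

theorem alternatingBit_succ (a : ℕ → ℕ → ℕ) (E : ℕ → ℕ) (u w : ℕ) :
    alternatingBit a E (u + 1) w = if E u ≠ 0 ∧ a u w ≠ 0 then 1 - alternatingBit a E u w
      else alternatingBit a E u w := by
  simp only [alternatingBit, Finset.sum_range_succ]
  split_ifs <;> omega

/-- The signs come in the order `-1, +1, -1, …`, so a partial sum is `0` or `-1` according to the
parity of the number of terms. -/
theorem sum_alternatingBit (a : ℕ → ℕ → ℕ) (E : ℕ → ℕ) (u w : ℕ) :
    ∑ x ∈ Finset.range u, (if E x ≠ 0 ∧ a x w ≠ 0 then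
      (2 * alternatingBit a E x w - 1 : ℤ) else 0) = - alternatingBit a E u w := by
  induction u with
  | zero => simp [alternatingBit]
  | succ u ih =>
    have h2 : alternatingBit a E u w < 2 := Nat.mod_lt _ (by norm_num)
    rw [Finset.sum_range_succ, ih, alternatingBit_succ]
    split_ifs
    · interval_cases alternatingBit a E u w <;> simp
    · rw [add_zero]

/-- The number of selected neighbours of `w` is even, for a selection whose rows add up to `0`. -/
theorem RowCombination.alternatingBit_eq_zero {f : ℕ → Bool} {a : ℕ → ℕ → ℕ} {N i w : ℕ}
    {E : ℕ → ℕ} (h : RowCombination f a N i (fun _ => 0) E) (ha : ∀ x < N, a x w ≤ 1)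
    (hw : w < N) : alternatingBit a E N w = 0 := by
  have h1 := h.row_eq w hw
  rw [alternatingBit, ← Nat.dvd_iff_mod_eq_zero, ← ZMod.natCast_eq_zero_iff, Nat.cast_sum]
  simp only [Nat.cast_zero] at h1
  refine Eq.trans (Finset.sum_congr rfl fun x hx => ?_) h1.symm
  rw [Finset.mem_range] at hx
  have h2 := h.coeff_le x hx
  have h3 := ha x hx
  interval_cases E x <;> interval_cases a x w <;> simp

/-! ### Subroutines: square root, multiplication table, row operations -/

namespace RAM

namespace Cmd

theorem mul_add_eq_mul_add_iff {N x y x' y' : ℕ} (hy : y < N) (hy' : y' < N) :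
    x * N + y = x' * N + y' ↔ x = x' ∧ y = y' := by
  refine ⟨fun h => ?_, by rintro ⟨rfl, rfl⟩; rfl⟩
  have hN : 0 < N := by omega
  have h1 := congrArg (· / N) h
  have h2 := congrArg (· % N) h
  simp only [mul_comm _ N, Nat.mul_add_div hN, Nat.div_eq_of_lt hy, Nat.div_eq_of_lt hy',
    Nat.mul_add_mod, Nat.mod_eq_of_lt hy, Nat.mod_eq_of_lt hy'] at h1 h2
  exact ⟨by omega, h2⟩

/-- Computes the square root of register `0` in register `2`. -/
def sqrtCmd : Cmd :=
  iter 4 (ite (.sub (.var 0) (.var 8))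
    (seq (assign 8 (.add (.add (.add (.var 8) (.var 2)) (.var 2)) (.const 1)))
      (assign 2 (.add (.var 2) (.const 1)))) skip)

/-- Register `8` holds the square of register `2`, updated by `(r + 1)² = r² + 2r + 1` for want of
multiplication. The candidate grows until its square reaches `n * n`, and then stays put for the
remaining rounds. -/
theorem run_sqrtCmd {σ : State} {n : ℕ} (h0 : σ.var 0 = n * n) (h2 : σ.var 2 = 0)
    (h8 : σ.var 8 = 0) : (sqrtCmd.run 0 σ).var 2 = n := by
  have key := run_iter_induction (b := 0) (x := 4) (σ := σ)
    (c := ite (.sub (.var 0) (.var 8))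
      (seq (assign 8 (.add (.add (.add (.var 8) (.var 2)) (.var 2)) (.const 1)))
      (assign 2 (.add (.var 2) (.const 1)))) skip)
    (fun k τ => τ.var 2 = min k n ∧ τ.var 8 = τ.var 2 * τ.var 2)
    (by simp [State.setVar_var, h2, h8])
    (fun k _ τ _ hv _ ⟨i2, i8⟩ => by
      have h0' : τ.var 0 = n * n := by rw [← h0]; exact hv 0 (by decide)
      rcases lt_or_ge k n with hk | hk
      · rw [min_eq_left hk.le] at i2
        have : τ.var 0 - τ.var 8 ≠ 0 := by
          rw [h0', i8, i2]
          have := Nat.mul_self_lt_mul_self hk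
          omega
        have e2 : min (k + 1) n = k + 1 := min_eq_left hk
        rw [run, if_neg (by simpa only [Exp.eval] using this)]
        simp [run, Exp.eval, State.setVar_var, i8, i2, e2]
        ring
      · rw [min_eq_right hk] at i2
        have : τ.var 0 - τ.var 8 = 0 := by rw [h0', i8, i2]; omega
        have e2 : min (k + 1) n = n := min_eq_right (by omega)
        rw [run, if_pos (by simpa only [Exp.eval] using this)]
        simp [run, State.setVar_var, i8, i2, e2])
  have := key.1
  rw [h0] at this
  rw [sqrtCmd, this]
  exact min_eq_right (Nat.le_mul_self n)

/-- Tabulates the multiples of register `2` in array `5`. -/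
def tableCmd : Cmd :=
  seq (assign 8 (.const 0))
    (iter 4 (seq (store 5 (.var 4) (.var 8)) (assign 8 (.add (.var 8) (.var 2)))))

theorem run_tableCmd (σ : State) :
    ∀ x < σ.var 2, (tableCmd.run 2 σ).arr 5 x = x * σ.var 2 := by
  rw [tableCmd, run]
  set σ' := (assign 8 (.const 0)).run 2 σ with hσ'
  have h2 : σ'.var 2 = σ.var 2 := run_var (by decide)
  have h8 : σ'.var 8 = 0 := by simp [hσ', run, State.setVar_var, Exp.eval]
  have key := run_iter_induction (b := 2) (x := 4) (σ := σ')
    (c := seq (store 5 (.var 4) (.var 8)) (assign 8 (.add (.var 8) (.var 2))))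
    (fun k τ => τ.var 8 = k * σ.var 2 ∧ ∀ x < k, τ.arr 5 x = x * σ.var 2)
    (by simp [State.setVar_var, h8])
    (fun k _ τ hk hv _ ⟨i8, i5⟩ => by
      have h2' : τ.var 2 = σ.var 2 := by rw [← h2]; exact hv 2 (by decide)
      simp only [run, Exp.eval, State.setVar_var, State.setArr_var, State.setVar_arr,
        State.setArr_arr, hk, i8, h2']
      refine ⟨by simp [Nat.succ_mul], fun x hx => ?_⟩
      by_cases hxk : x = k
      · simp [hxk]
      · simp [hxk, i5 x (by omega)])
  rw [h2] at key
  exact key.2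

/-- The expression for the position of the entry `(x, y)` of a matrix. -/
def pos (x y : ℕ) : Exp := .add (.load 5 (.var x)) (.var y)

/-- Loads row number `i` (register `4`) into array `6`, and a unit vector into array `7`. -/
def rowInit : Cmd :=
  seq (iter 6 (seq (store 6 (.var 6) (.load 0 (pos 4 6))) (store 7 (.var 6) (.const 0))))
    (store 7 (.var 4) (.const 1))

theorem run_rowInit {σ : State} (hT : σ.arr 5 (σ.var 4) = σ.var 4 * σ.var 2) :
    ∀ l < σ.var 2, (rowInit.run 2 σ).arr 6 l = σ.arr 0 (σ.var 4 * σ.var 2 + l) ∧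
      (rowInit.run 2 σ).arr 7 l = if l = σ.var 4 then 1 else 0 := by
  have key := run_iter_induction (b := 2) (x := 6) (σ := σ)
    (c := seq (store 6 (.var 6) (.load 0 (pos 4 6))) (store 7 (.var 6) (.const 0)))
    (fun k τ => ∀ l < k, τ.arr 6 l = σ.arr 0 (σ.var 4 * σ.var 2 + l) ∧ τ.arr 7 l = 0)
    (by simp)
    (fun k _ τ hk hv ha ih l hl => by
      have h4 : τ.var 4 = σ.var 4 := hv 4 (by decide)
      have h5 : τ.arr 5 = σ.arr 5 := ha 5 (by decide)
      have h0 : τ.arr 0 = σ.arr 0 := ha 0 (by decide)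
      simp only [run, Exp.eval, pos, State.setVar_arr, State.setArr_arr, State.setArr_var, hk, h4,
        h5, h0, hT]
      by_cases hlk : l = k
      · simp [hlk]
      · simpa [hlk] using ih l (by omega))
  intro l hl
  rw [rowInit, run]
  set τ := (iter 6 (seq (store 6 (.var 6) (.load 0 (pos 4 6)))
    (store 7 (.var 6) (.const 0)))).run 2 σ with hτ
  have h4 : τ.var 4 = σ.var 4 := run_var (by decide)
  simp only [run, Exp.eval, State.setArr_arr, h4]
  refine ⟨by simpa using (key l hl).1, ?_⟩
  by_cases hl4 : l = σ.var 4
  · simp [hl4]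
  · simpa [hl4] using (key l hl).2

/-- The expression for the sum modulo `2` of two bits. -/
def xorExp (e f : Exp) : Exp := .add (.sub e f) (.sub f e)

/-- Adds the stored row number `k` (register `5`) to the current row. -/
def rowAdd : Cmd :=
  iter 6 (seq (store 6 (.var 6) (xorExp (.load 6 (.var 6)) (.load 2 (pos 5 6))))
    (store 7 (.var 6) (xorExp (.load 7 (.var 6)) (.load 3 (pos 5 6)))))

theorem run_rowAdd {σ : State} (hT : σ.arr 5 (σ.var 5) = σ.var 5 * σ.var 2) :
    ∀ l < σ.var 2,
      (rowAdd.run 2 σ).arr 6 l = σ.arr 6 l - σ.arr 2 (σ.var 5 * σ.var 2 + l) +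
        (σ.arr 2 (σ.var 5 * σ.var 2 + l) - σ.arr 6 l) ∧
      (rowAdd.run 2 σ).arr 7 l = σ.arr 7 l - σ.arr 3 (σ.var 5 * σ.var 2 + l) +
        (σ.arr 3 (σ.var 5 * σ.var 2 + l) - σ.arr 7 l) := by
  have key := run_iter_induction (b := 2) (x := 6) (σ := σ)
    (c := seq (store 6 (.var 6) (xorExp (.load 6 (.var 6)) (.load 2 (pos 5 6))))
      (store 7 (.var 6) (xorExp (.load 7 (.var 6)) (.load 3 (pos 5 6)))))
    (fun k τ => (∀ l < k, τ.arr 6 l = σ.arr 6 l - σ.arr 2 (σ.var 5 * σ.var 2 + l) +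
        (σ.arr 2 (σ.var 5 * σ.var 2 + l) - σ.arr 6 l) ∧
      τ.arr 7 l = σ.arr 7 l - σ.arr 3 (σ.var 5 * σ.var 2 + l) +
        (σ.arr 3 (σ.var 5 * σ.var 2 + l) - σ.arr 7 l)) ∧
      -- The rows are updated in place, so the invariant must also say that the cells ahead still
      -- hold their old values.
      ∀ l, k ≤ l → τ.arr 6 l = σ.arr 6 l ∧ τ.arr 7 l = σ.arr 7 l)
    (by simp)
    (fun k _ τ hk hv ha ⟨ih, ih'⟩ => by
      have h4 : τ.var 5 = σ.var 5 := hv 5 (by decide)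
      have h5 : τ.arr 5 = σ.arr 5 := ha 5 (by decide)
      have h2 : τ.arr 2 = σ.arr 2 := ha 2 (by decide)
      have h3 : τ.arr 3 = σ.arr 3 := ha 3 (by decide)
      simp only [run, Exp.eval, pos, xorExp, State.setVar_arr, State.setArr_arr, State.setArr_var,
        hk, h4, h5, h2, h3, hT]
      refine ⟨fun l hl => ?_, fun l hl => ?_⟩
      · by_cases hlk : l = k
        · simp [hlk, ih' k le_rfl]
        · simpa [hlk] using ih l (by omega)
      · have hlk : l ≠ k := by omega
        simpa [hlk] using ih' l (by omega))
  exact key.1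

/-- Reduces the current row by the stored rows, according to their pivots. -/
def rowReduce : Cmd :=
  iter 5 (ite (.load 6 (.load 4 (.var 5)))
    (ite (.load 2 (.add (.load 5 (.var 5)) (.load 4 (.var 5)))) rowAdd skip) skip)

/-- Stores the current row, its coefficients, and its pivot; register `7` tells whether it has
one. -/
def rowSave : Cmd :=
  seq (assign 7 (.const 0))
    (iter 6 (seq (store 2 (pos 4 6) (.load 6 (.var 6)))
      (seq (store 3 (pos 4 6) (.load 7 (.var 6)))
        (ite (.load 6 (.var 6)) (seq (store 4 (.var 4) (.var 6)) (assign 7 (.const 1))) skip))))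

/-- The pivot is the last nonzero position, since each nonzero entry overwrites the previous
candidate. A zero row leaves its pivot cell as it was, so a stored pivot is meaningful only if the
stored row is nonzero there. -/
theorem run_rowSave {σ : State} (hT : σ.arr 5 (σ.var 4) = σ.var 4 * σ.var 2) :
    (∀ x, ∀ l < σ.var 2, (rowSave.run 2 σ).arr 2 (x * σ.var 2 + l) =
      if x = σ.var 4 then σ.arr 6 l else σ.arr 2 (x * σ.var 2 + l)) ∧
    (∀ x, ∀ l < σ.var 2, (rowSave.run 2 σ).arr 3 (x * σ.var 2 + l) =
      if x = σ.var 4 then σ.arr 7 l else σ.arr 3 (x * σ.var 2 + l)) ∧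
    (∀ x ≠ σ.var 4, (rowSave.run 2 σ).arr 4 x = σ.arr 4 x) ∧
    (((rowSave.run 2 σ).var 7 = 0 ∧ (∀ l < σ.var 2, σ.arr 6 l = 0) ∧
      (rowSave.run 2 σ).arr 4 (σ.var 4) = σ.arr 4 (σ.var 4)) ∨
     ((rowSave.run 2 σ).var 7 ≠ 0 ∧ (rowSave.run 2 σ).arr 4 (σ.var 4) < σ.var 2 ∧
      σ.arr 6 ((rowSave.run 2 σ).arr 4 (σ.var 4)) ≠ 0)) := by
  rw [rowSave, run]
  set σ' := (assign 7 (.const 0)).run 2 σ with hσ'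
  have hvar : ∀ y ≠ 7, σ'.var y = σ.var y := fun y hy => by simp [hσ', run, State.setVar_var, hy]
  have harr : σ'.arr = σ.arr := rfl
  have h7 : σ'.var 7 = 0 := by simp [hσ', run, State.setVar_var, Exp.eval]
  clear_value σ'
  set N := σ.var 2 with hN
  set i := σ.var 4 with hi
  have key := run_iter_induction (b := 2) (x := 6) (σ := σ')
    (c := seq (store 2 (pos 4 6) (.load 6 (.var 6)))
      (seq (store 3 (pos 4 6) (.load 7 (.var 6)))
        (ite (.load 6 (.var 6)) (seq (store 4 (.var 4) (.var 6)) (assign 7 (.const 1))) skip)))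
    (fun k τ =>
      (∀ x, ∀ l < N, τ.arr 2 (x * N + l) =
        if x = i ∧ l < k then σ.arr 6 l else σ.arr 2 (x * N + l)) ∧
      (∀ x, ∀ l < N, τ.arr 3 (x * N + l) =
        if x = i ∧ l < k then σ.arr 7 l else σ.arr 3 (x * N + l)) ∧
      (∀ x ≠ i, τ.arr 4 x = σ.arr 4 x) ∧
      ((τ.var 7 = 0 ∧ (∀ l < k, σ.arr 6 l = 0) ∧ τ.arr 4 i = σ.arr 4 i) ∨
       (τ.var 7 ≠ 0 ∧ τ.arr 4 i < N ∧ σ.arr 6 (τ.arr 4 i) ≠ 0)))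
    (by simp [State.setVar_var, harr, h7])
    (fun k hkN τ hk hv ha ⟨i2, i3, i4, ip⟩ => by
      have h4 : τ.var 4 = i := (hv 4 (by decide)).trans (hvar 4 (by decide))
      have h5 : τ.arr 5 = σ.arr 5 := (ha 5 (by decide)).trans (by rw [harr])
      have h6 : τ.arr 6 = σ.arr 6 := (ha 6 (by decide)).trans (by rw [harr])
      have h7 : τ.arr 7 = σ.arr 7 := (ha 7 (by decide)).trans (by rw [harr])
      rw [hvar 2 (by decide), ← hN] at hkN
      set τ' := ((store 2 (pos 4 6) (.load 6 (.var 6))).seq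
        (store 3 (pos 4 6) (.load 7 (.var 6)))).run 2 τ with hτ'
      have e2 : ∀ x, ∀ l < N, τ'.arr 2 (x * N + l) =
          if x = i ∧ l < k + 1 then σ.arr 6 l else σ.arr 2 (x * N + l) := by
        intro x l hl
        simp only [hτ', run, Exp.eval, pos, State.setArr_arr, State.setArr_var, h4, h5, h6,
          hk, hT, i2 x l hl]
        simp only [mul_add_eq_mul_add_iff hl hkN]
        have hlt : l < k + 1 ↔ l < k ∨ l = k := by omega
        by_cases hx : x = i <;> by_cases hlk : l = k <;> simp [hx, hlk, hlt]
      have e3 : ∀ x, ∀ l < N, τ'.arr 3 (x * N + l) =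
          if x = i ∧ l < k + 1 then σ.arr 7 l else σ.arr 3 (x * N + l) := by
        intro x l hl
        simp only [hτ', run, Exp.eval, pos, State.setArr_arr, State.setArr_var, h4, h5, h7,
          hk, hT, i3 x l hl]
        rw [if_neg (show ¬ (5 = 2 ∧ _) by simp)]
        simp only [mul_add_eq_mul_add_iff hl hkN]
        have hlt : l < k + 1 ↔ l < k ∨ l = k := by omega
        by_cases hx : x = i <;> by_cases hlk : l = k <;> simp [hx, hlk, hlt]
      have e4 : τ'.arr 4 = τ.arr 4 := run_arr (by decide)
      have e6 : τ'.arr 6 = σ.arr 6 := (run_arr (by decide)).trans h6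
      have ev : τ'.var = τ.var := rfl
      have hrun : run 2 (seq (store 2 (pos 4 6) (.load 6 (.var 6)))
        (seq (store 3 (pos 4 6) (.load 7 (.var 6)))
        (ite (.load 6 (.var 6)) (seq (store 4 (.var 4) (.var 6)) (assign 7 (.const 1))) skip))) τ =
          run 2 (ite (.load 6 (.var 6)) (seq (store 4 (.var 4) (.var 6)) (assign 7 (.const 1)))
            skip) τ' := rfl
      rw [hrun]
      clear_value τ'
      by_cases hW : σ.arr 6 k = 0
      · simp only [run, Exp.eval, e6, ev, hk, hW, if_true, State.setVar_arr, State.setVar_var, e4]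
        refine ⟨e2, e3, i4, ip.imp ?_ id⟩
        rintro ⟨j1, j2, j3⟩
        refine ⟨j1, fun l hl => ?_, j3⟩
        rcases Nat.lt_succ_iff_lt_or_eq.1 hl with hl | rfl
        · exact j2 l hl
        · exact hW
      · simp only [run, Exp.eval, e6, ev, hk, hW, if_false, State.setVar_arr, State.setVar_var, e4,
          State.setArr_arr, State.setArr_var, h4]
        refine ⟨by simpa using e2, by simpa using e3, fun x hx => by simp [hx, i4 x hx], ?_⟩
        right
        simp [hkN, hW])
  rw [hvar 2 (by decide), ← hN] at key
  obtain ⟨k2, k3, k4, kp⟩ := key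
  refine ⟨fun x l hl => ?_, fun x l hl => ?_, k4, kp⟩
  · simpa [hl] using k2 x l hl
  · simpa [hl] using k3 x l hl

/-- Copies the coefficients of the current row to array `8` if that row is zero. -/
def recordCmd : Cmd :=
  ite (.var 7) skip (seq (assign 3 (.const 1)) (iter 6 (store 8 (.var 6) (.load 7 (.var 6)))))

theorem run_recordCmd_of_ne {σ : State} (h : σ.var 7 ≠ 0) : recordCmd.run 2 σ = σ := by
  simp [recordCmd, run, Exp.eval, h]

theorem run_recordCmd {σ : State} (h : σ.var 7 = 0) : (recordCmd.run 2 σ).var 3 = 1 ∧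
    ∀ l < σ.var 2, (recordCmd.run 2 σ).arr 8 l = σ.arr 7 l := by
  rw [recordCmd, run, if_pos (by simpa [Exp.eval] using h), run]
  have key := run_iter_induction (b := 2) (x := 6) (σ := σ.setVar 3 1)
    (c := store 8 (.var 6) (.load 7 (.var 6)))
    (fun k τ => τ.var 3 = 1 ∧ ∀ l < k, τ.arr 8 l = σ.arr 7 l)
    (by simp [State.setVar_var])
    (fun k _ τ hk _ ha ⟨ih3, ih⟩ => by
      have h7 : τ.arr 7 = σ.arr 7 := ha 7 (by decide)
      simp only [run, Exp.eval, State.setVar_arr, State.setArr_arr, State.setVar_var,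
        State.setArr_var, hk, h7]
      refine ⟨by simpa using ih3, fun l hl => ?_⟩
      by_cases hlk : l = k
      · simp [hlk]
      · simpa [hlk] using ih l (by omega))
  exact key

end Cmd

end RAM

/-! ### Correctness of the elimination -/

namespace RAM

namespace Cmd

variable {f : ℕ → Bool} {a : ℕ → ℕ → ℕ} {N : ℕ}

/-- The state of the elimination when the rows below `i` have been treated. -/
structure Eliminated (f : ℕ → Bool) (a : ℕ → ℕ → ℕ) (N i : ℕ) (σ : State) : Prop where
  rows : ∀ k < i, RowCombination f a N k (fun l => σ.arr 2 (k * N + l))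
    (fun l => σ.arr 3 (k * N + l))
  later : ∀ k, i ≤ k → ∀ l < N, σ.arr 2 (k * N + l) = 0
  pivot_lt : ∀ k < N, σ.arr 4 k < N
  triangular : ∀ k k', k < k' → k' < i → σ.arr 2 (k * N + σ.arr 4 k) ≠ 0 →
    σ.arr 2 (k' * N + σ.arr 4 k) = 0
  independent : σ.var 3 = 0 → ∀ k < i, σ.arr 2 (k * N + σ.arr 4 k) ≠ 0
  dependent : σ.var 3 ≠ 0 → ∃ j < N, RowCombination f a N j (fun _ => 0) (σ.arr 8)

/-- Adding row `k` clears the column of its pivot, and does not spoil the columns cleared before,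
because `triangular` says that row `k` vanishes at the pivots of earlier nonzero rows. -/
theorem run_rowReduce {σ : State} {i : ℕ} (hN : σ.var 2 = N) (hi : i < N)
    (hT : ∀ k < N, σ.arr 5 k = k * N) (hσ : Eliminated f a N i σ)
    (hrow : RowCombination f a N i (σ.arr 6) (σ.arr 7)) :
    RowCombination f a N i ((rowReduce.run 2 σ).arr 6) ((rowReduce.run 2 σ).arr 7) ∧
    ∀ k < i, σ.arr 2 (k * N + σ.arr 4 k) ≠ 0 → (rowReduce.run 2 σ).arr 6 (σ.arr 4 k) = 0 := by
  have key := run_iter_induction (b := 2) (x := 5) (σ := σ)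
    (c := ite (.load 6 (.load 4 (.var 5)))
      (ite (.load 2 (.add (.load 5 (.var 5)) (.load 4 (.var 5)))) rowAdd skip) skip)
    (fun m τ => RowCombination f a N i (τ.arr 6) (τ.arr 7) ∧
      ∀ k < m, k < i → σ.arr 2 (k * N + σ.arr 4 k) ≠ 0 → τ.arr 6 (σ.arr 4 k) = 0)
    ⟨hrow, by simp⟩
    (fun k hkN τ hk hv ha ⟨ih1, ih2⟩ => by
      have h2 : τ.var 2 = N := (hv 2 (by decide)).trans hN
      have h5 : τ.arr 5 = σ.arr 5 := ha 5 (by decide)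
      have a2 : τ.arr 2 = σ.arr 2 := ha 2 (by decide)
      have a3 : τ.arr 3 = σ.arr 3 := ha 3 (by decide)
      have a4 : τ.arr 4 = σ.arr 4 := ha 4 (by decide)
      rw [hN] at hkN
      have hp := hσ.pivot_lt k hkN
      simp only [State.setVar_arr, run, Exp.eval, hk, h5, a2, a4, hT k hkN]
      by_cases hW : τ.arr 6 (σ.arr 4 k) = 0
      · rw [if_pos hW]
        refine ⟨ih1, fun k' hk' hki hne => ?_⟩
        rcases Nat.lt_succ_iff_lt_or_eq.1 hk' with h | rfl
        · exact ih2 k' h hki hne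
        · exact hW
      rw [if_neg hW]
      by_cases hR : σ.arr 2 (k * N + σ.arr 4 k) = 0
      · rw [if_pos hR]
        refine ⟨ih1, fun k' hk' hki hne => ?_⟩
        rcases Nat.lt_succ_iff_lt_or_eq.1 hk' with h | rfl
        · exact ih2 k' h hki hne
        · exact absurd hR hne
      rw [if_neg hR]
      -- The loop passes over all `k < N`, but rows from `i` on are still zero in storage, so the
      -- second test filters them out.
      have hki : k < i := by
        by_contra hge
        exact hR (hσ.later k (not_lt.1 hge) _ hp)
      have hadd := run_rowAdd (σ := τ) (by rw [hk, h5, h2, hT k hkN])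
      rw [hk, h2, a2, a3] at hadd
      have hrk := hσ.rows k hki
      refine ⟨ih1.add hrk hki hi hp hW hR (fun l hl => (hadd l hl).1) (fun l hl => (hadd l hl).2),
        fun k' hk' hki' hne => ?_⟩
      rcases Nat.lt_succ_iff_lt_or_eq.1 hk' with h | rfl
      · rw [(hadd _ (hσ.pivot_lt k' (hki'.trans hi))).1, ih2 k' h hki' hne,
          hσ.triangular k' k h hki hne]
      · rw [(hadd _ hp).1]
        have h1 := ih1.row_le _ hp
        have h2 := hrk.row_le _ hp
        omega)
  rw [hN] at key
  exact ⟨key.1, fun k hk => key.2 k (hk.trans hi) hk⟩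

/-- Finds a dependency modulo `2` between the rows of the input, if there is one. -/
def eliminate : Cmd :=
  iter 4 (seq (seq rowInit rowReduce) (seq rowSave recordCmd))

theorem run_eliminate {σ : State} (hN : σ.var 2 = N) (hT : ∀ k < N, σ.arr 5 k = k * N)
    (hA : ∀ x < N, ∀ y < N, σ.arr 0 (x * N + y) = a x y) (ha : ∀ x < N, ∀ y < N, a x y ≤ 1)
    (hf : ∀ x < N, ∀ y < N, a x y ≠ 0 → f y ≠ f x) (h2 : ∀ j, σ.arr 2 j = 0)
    (h4 : ∀ j, σ.arr 4 j = 0) (h3 : σ.var 3 = 0) :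
    Eliminated f a N N (eliminate.run 2 σ) := by
  have key := run_iter_induction (b := 2) (x := 4) (σ := σ)
    (c := seq (seq rowInit rowReduce) (seq rowSave recordCmd)) (Eliminated f a N)
    -- All pivots are initially the default `0`, which is below `N` as soon as some `k < N` exists.
    ⟨by simp, by simp [h2], fun k hk => by simpa [h4] using Nat.zero_lt_of_lt hk, by simp, by simp,
      by simp [State.setVar_var, h3]⟩
    (fun i hiN τ hi hv har ih => by
      have v2 : τ.var 2 = N := (hv 2 (by decide)).trans hN
      have a0 : τ.arr 0 = σ.arr 0 := har 0 (by decide)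
      have a5 : τ.arr 5 = σ.arr 5 := har 5 (by decide)
      rw [hN] at hiN
      suffices h : Eliminated f a N (i + 1)
          (((rowInit.seq rowReduce).seq (rowSave.seq recordCmd)).run 2 τ) from
        ⟨h.rows, h.later, h.pivot_lt, h.triangular, by simpa [State.setVar_var] using h.independent,
          by simpa [State.setVar_var] using h.dependent⟩
      rw [run, run, run]
      -- the current row, before and after its reduction
      have hinit := run_rowInit (σ := τ) (by rw [hi, v2, a5, hT i hiN])
      rw [hi, v2, a0] at hinit
      set τ₁ := rowInit.run 2 τ with hτ₁
      have ih₁ : Eliminated f a N i τ₁ := by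
        have e2 : τ₁.arr 2 = τ.arr 2 := run_arr (by decide)
        have e3 : τ₁.arr 3 = τ.arr 3 := run_arr (by decide)
        have e4 : τ₁.arr 4 = τ.arr 4 := run_arr (by decide)
        have e8 : τ₁.arr 8 = τ.arr 8 := run_arr (by decide)
        have ev : τ₁.var 3 = τ.var 3 := run_var (by decide)
        constructor <;> simp only [e2, e3, e4, e8, ev]
        exacts [ih.rows, ih.later, ih.pivot_lt, ih.triangular, ih.independent, ih.dependent]
      have hrow₁ : RowCombination f a N i (τ₁.arr 6) (τ₁.arr 7) :=
        .self hiN (ha i hiN) (hf i hiN) (fun l hl => by rw [(hinit l hl).1, hA i hiN l hl])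
          (fun l hl => (hinit l hl).2)
      have v2₁ : τ₁.var 2 = N := (run_var (by decide)).trans v2
      have v4₁ : τ₁.var 4 = i := (run_var (by decide)).trans hi
      have a5₁ : ∀ k < N, τ₁.arr 5 k = k * N := fun k hk => by
        rw [hτ₁, run_arr (by decide), a5, hT k hk]
      clear_value τ₁
      obtain ⟨hrow₂, hred⟩ := run_rowReduce v2₁ hiN a5₁ ih₁ hrow₁
      set τ₂ := rowReduce.run 2 τ₁ with hτ₂
      have e2 : τ₂.arr 2 = τ₁.arr 2 := run_arr (by decide)
      have e3 : τ₂.arr 3 = τ₁.arr 3 := run_arr (by decide)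
      have e4 : τ₂.arr 4 = τ₁.arr 4 := run_arr (by decide)
      have e5 : τ₂.arr 5 = τ₁.arr 5 := run_arr (by decide)
      have e8 : τ₂.arr 8 = τ₁.arr 8 := run_arr (by decide)
      have ev : τ₂.var 3 = τ₁.var 3 := run_var (by decide)
      have v2₂ : τ₂.var 2 = N := (run_var (by decide)).trans v2₁
      have v4₂ : τ₂.var 4 = i := (run_var (by decide)).trans v4₁
      clear_value τ₂
      have hsave := run_rowSave (σ := τ₂) (by rw [v4₂, v2₂, e5, a5₁ i hiN])
      rw [v2₂, v4₂, e2, e3, e4] at hsave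
      set τ₃ := rowSave.run 2 τ₂ with hτ₃
      have g7 : τ₃.arr 7 = τ₂.arr 7 := run_arr (by decide)
      have g8 : τ₃.arr 8 = τ₁.arr 8 := (run_arr (by decide)).trans e8
      have gv : τ₃.var 3 = τ₁.var 3 := (run_var (by decide)).trans ev
      have v2₃ : τ₃.var 2 = N := (run_var (by decide)).trans v2₂
      clear_value τ₃
      obtain ⟨s2, s3, s4, s7⟩ := hsave
      set τ₄ := recordCmd.run 2 τ₃ with hτ₄
      have f2 : τ₄.arr 2 = τ₃.arr 2 := run_arr (by decide)
      have f3 : τ₄.arr 3 = τ₃.arr 3 := run_arr (by decide)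
      have f4 : τ₄.arr 4 = τ₃.arr 4 := run_arr (by decide)
      have s2' : ∀ k < i, ∀ l < N, τ₃.arr 2 (k * N + l) = τ₁.arr 2 (k * N + l) :=
        fun k hk l hl => by rw [s2 k l hl, if_neg hk.ne]
      have s3' : ∀ k < i, ∀ l < N, τ₃.arr 3 (k * N + l) = τ₁.arr 3 (k * N + l) :=
        fun k hk l hl => by rw [s3 k l hl, if_neg hk.ne]
      have s4' : ∀ k < i, τ₃.arr 4 k = τ₁.arr 4 k := fun k hk => s4 k hk.ne
      have hpiv : ∀ k < N, τ₃.arr 4 k < N := fun k hk => by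
        by_cases hki : k = i
        · subst hki
          rcases s7 with ⟨_, _, h⟩ | ⟨_, h, _⟩
          · rw [h]; exact ih₁.pivot_lt k hk
          · exact h
        · rw [s4 k hki]; exact ih₁.pivot_lt k hk
      refine ⟨fun k hk => ?_, fun k hk l hl => ?_, by rwa [f4], fun k k' hkk' hk' hne => ?_, ?_, ?_⟩
      · simp only [f2, f3]
        rcases Nat.lt_succ_iff_lt_or_eq.1 hk with h | rfl
        · exact (ih₁.rows k h).congr (h.trans hiN) (s2' k h) (s3' k h)
        · exact hrow₂.congr hiN (fun l hl => by rw [s2 k l hl, if_pos rfl])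
            (fun l hl => by rw [s3 k l hl, if_pos rfl])
      · rw [f2, s2 k l hl, if_neg (by omega)]
        exact ih₁.later k (by omega) l hl
      · have hki : k < i := by omega
        have hp := ih₁.pivot_lt k (hki.trans hiN)
        rw [f2, f4, s4' k hki, s2' k hki _ hp] at hne
        rw [f2, f4, s4' k hki]
        rcases Nat.lt_succ_iff_lt_or_eq.1 hk' with h | rfl
        · rw [s2' k' h _ hp]
          exact ih₁.triangular k k' hkk' h hne
        · rw [s2 k' _ hp, if_pos rfl]
          exact hred k hki hne
      · intro h3' k hk
        rw [f2, f4]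
        rcases s7 with ⟨h, _⟩ | ⟨h, h', h''⟩
        · rw [(run_recordCmd h).1] at h3'
          exact absurd h3' one_ne_zero
        · rcases Nat.lt_succ_iff_lt_or_eq.1 hk with hk | rfl
          · rw [s4' k hk, s2' k hk _ (ih₁.pivot_lt k (hk.trans hiN))]
            refine ih₁.independent ?_ k hk
            rw [← gv, ← h3', hτ₄, run_recordCmd_of_ne h]
          · rwa [s2 k _ h', if_pos rfl]
      · intro h3'
        rcases s7 with ⟨h, h', _⟩ | ⟨h, _⟩
        -- The current row has been reduced to zero, so its coefficients form a dependency; an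
        -- earlier recorded one is overwritten.
        · exact ⟨i, hiN, hrow₂.congr hiN (fun l hl => (h' l hl).symm) (fun l hl => by
            rw [(run_recordCmd h).2 l (by rwa [v2₃]), g7])⟩
        · rw [hτ₄, run_recordCmd_of_ne h] at h3' ⊢
          rw [g8]
          exact ih₁.dependent (by rwa [← gv]))
  rw [hN] at key
  exact key

/-! ### Writing the signing -/

/-- The expression for the position of the output bit for the entry `(x, y)`. -/
def outPos (x y : ℕ) : Exp := .add (pos x y) (.const 1)

/-- The step of `signColumn` at an entry. -/
def signEntry : Cmd :=
  ite (.load 8 (.var 5)) (ite (.load 0 (pos 5 4))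
    (seq (seq (store 1 (outPos 5 4) (.var 9)) (store 1 (outPos 4 5) (.var 9)))
      (assign 9 (.sub (.const 1) (.var 9)))) skip) skip

/-- Gives alternating signs to the selected entries of column number `w` (register `4`). -/
def signColumn : Cmd :=
  seq (assign 9 (.const 0)) (iter 5 signEntry)

/-- The signing that is written when the columns before `w`, and the entries before `u` of column
`w`, have been treated. -/
structure Signed (a : ℕ → ℕ → ℕ) (N w u : ℕ) (E : ℕ → ℕ) (s : ℕ → ℕ) : Prop where
  head : s 0 = 1
  le : ∀ j, s j ≤ 1
  symm : ∀ x < N, ∀ y < N, s (x * N + y + 1) = s (y * N + x + 1)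
  alternating : ∀ x < N, ∀ y < N, E x ≠ 0 → a x y ≠ 0 → y < w ∨ y = w ∧ x < u →
    s (x * N + y + 1) = alternatingBit a E x y

/-- Writing the entry and its mirror image together preserves symmetry. The mirror image lies in row
`w`, which is not selected, so no alternating entry is disturbed. -/
theorem Signed.update {w u v : ℕ} {E s s' : ℕ → ℕ} (h : Signed a N w u E s) (hw : w < N)
    (hu : u < N) (hE : E w = 0) (hv : v = alternatingBit a E u w)
    (hs' : ∀ j, s' j = if j = u * N + w + 1 ∨ j = w * N + u + 1 then v else s j) :
    Signed a N w (u + 1) E s' where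
  head := by rw [hs', if_neg (by omega), h.head]
  le j := by
    rw [hs']
    split_ifs
    · rw [hv]
      exact Nat.lt_succ_iff.1 (Nat.mod_lt _ two_pos)
    · exact h.le j
  symm x hx y hy := by
    simp only [hs', add_left_inj, mul_add_eq_mul_add_iff hy hw, mul_add_eq_mul_add_iff hy hu,
      mul_add_eq_mul_add_iff hx hw, mul_add_eq_mul_add_iff hx hu, h.symm x hx y hy]
    congr 1
    simp only [eq_iff_iff]
    tauto
  alternating x hx y hy hEx haxy hxy := by
    simp only [hs', add_left_inj, mul_add_eq_mul_add_iff hy hw, mul_add_eq_mul_add_iff hy hu]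
    have hxw : x ≠ w := fun hh => hEx (by rw [hh, hE])
    by_cases hc : x = u ∧ y = w
    · rw [if_pos (Or.inl hc), hv, hc.1, hc.2]
    · rw [if_neg (by tauto)]
      exact h.alternating x hx y hy hEx haxy (by omega)

theorem Signed.skip {w u : ℕ} {E s : ℕ → ℕ} (h : Signed a N w u E s)
    (hu : E u = 0 ∨ a u w = 0) : Signed a N w (u + 1) E s where
  head := h.head
  le := h.le
  symm := h.symm
  alternating x hx y hy hEx haxy hxy := by
    refine h.alternating x hx y hy hEx haxy ?_
    by_cases hc : x = u ∧ y = w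
    · rw [hc.1] at hEx haxy
      rw [hc.2] at haxy
      tauto
    · omega

/-- The hypothesis `hind` says that the selected vertices are independent; it is what makes each
mirror write harmless. Register `9` carries the parity of the selected neighbours met so far. -/
theorem run_signColumn {σ : State} {w : ℕ} {E : ℕ → ℕ} (hN : σ.var 2 = N) (h4 : σ.var 4 = w)
    (hw : w < N) (hT : ∀ k < N, σ.arr 5 k = k * N)
    (hA : ∀ x < N, ∀ y < N, σ.arr 0 (x * N + y) = a x y) (hE : σ.arr 8 = E)
    (hind : ∀ x < N, ∀ y < N, E x ≠ 0 → a x y ≠ 0 → E y = 0)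
    (hσ : Signed a N w 0 E (σ.arr 1)) : Signed a N (w + 1) 0 E ((signColumn.run 2 σ).arr 1) := by
  rw [signColumn, run]
  set σ' := (assign 9 (.const 0)).run 2 σ with hσ'
  have hN' : σ'.var 2 = N := (run_var (by decide)).trans hN
  have h4' : σ'.var 4 = w := (run_var (by decide)).trans h4
  have h9 : σ'.var 9 = 0 := by simp [hσ', run, State.setVar_var, Exp.eval]
  have harr : σ'.arr = σ.arr := rfl
  clear_value σ'
  have key := run_iter_induction (b := 2) (x := 5) (σ := σ') (c := signEntry)
    (fun u τ => Signed a N w u E (τ.arr 1) ∧ τ.var 9 = alternatingBit a E u w)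
    ⟨by simpa [harr] using hσ, by simp [State.setVar_var, h9, alternatingBit]⟩
    (fun u hu τ hk hv ha ⟨ih, ih9⟩ => by
      have v4 : τ.var 4 = w := (hv 4 (by decide)).trans h4'
      have a0 : τ.arr 0 = σ.arr 0 := (ha 0 (by decide)).trans (by rw [harr])
      have a5 : τ.arr 5 = σ.arr 5 := (ha 5 (by decide)).trans (by rw [harr])
      have a8 : τ.arr 8 = E := (ha 8 (by decide)).trans (by rw [harr, hE])
      rw [hN'] at hu
      simp only [State.setVar_arr, State.setVar_var, if_neg (show (9 : ℕ) ≠ 5 by decide)]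
      rw [signEntry, run]
      simp only [Exp.eval, hk, a8]
      by_cases hEu : E u = 0
      · rw [if_pos hEu]
        exact ⟨ih.skip (.inl hEu), by simp [run, ih9, alternatingBit_succ, hEu]⟩
      rw [if_neg hEu, run]
      simp only [Exp.eval, pos, hk, a5, v4, a0, hT u hu, hA u hu w hw]
      by_cases hauw : a u w = 0
      · rw [if_pos hauw]
        exact ⟨ih.skip (.inr hauw), by simp [run, ih9, alternatingBit_succ, hauw]⟩
      rw [if_neg hauw]
      refine ⟨ih.update hw hu (hind u hu w hw hEu hauw) ih9 fun j => ?_, ?_⟩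
      · simp only [run, Exp.eval, outPos, pos, State.setVar_arr, State.setArr_arr,
          State.setArr_var, hk, v4]
        rw [if_neg (show ¬ (5 = 1 ∧ _) by simp), a5, hT u hu, hT w hw]
        by_cases h1 : j = u * N + w + 1 <;> by_cases h2 : j = w * N + u + 1 <;> simp [h1, h2]
      · simp [run, Exp.eval, State.setVar_var, ih9, alternatingBit_succ, hEu, hauw])
  obtain ⟨key, -⟩ := key
  rw [hN'] at key
  exact ⟨key.head, key.le, key.symm, fun x hx y hy hEx haxy hxy =>
    key.alternating x hx y hy hEx haxy (by omega)⟩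

/-- Writes the output. -/
def writeAnswer : Cmd :=
  ite (.var 3) (seq (seq (assign 1 (.add (.var 0) (.const 1)))
    (store 1 (.const 0) (.const 1))) (iter 4 signColumn)) (assign 1 (.const 1))

theorem run_writeAnswer {σ : State} {E : ℕ → ℕ} (hN : σ.var 2 = N)
    (hT : ∀ k < N, σ.arr 5 k = k * N) (hA : ∀ x < N, ∀ y < N, σ.arr 0 (x * N + y) = a x y)
    (hE : σ.arr 8 = E) (hind : ∀ x < N, ∀ y < N, E x ≠ 0 → a x y ≠ 0 → E y = 0)
    (h1 : ∀ j, σ.arr 1 j = 0) (h3 : σ.var 3 ≠ 0) :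
    (writeAnswer.run 2 σ).var 1 = σ.var 0 + 1 ∧
      Signed a N N 0 E ((writeAnswer.run 2 σ).arr 1) := by
  rw [writeAnswer, run, if_neg (by simpa [Exp.eval] using h3), run]
  set σ' := (seq (assign 1 (.add (.var 0) (.const 1))) (store 1 (.const 0) (.const 1))).run 2 σ
    with hσ'
  have hN' : σ'.var 2 = N := (run_var (by decide)).trans hN
  have v1 : σ'.var 1 = σ.var 0 + 1 := by
    simp [hσ', run, State.setVar_var, Exp.eval]
  have a0 : σ'.arr 0 = σ.arr 0 := run_arr (by decide)
  have a5 : σ'.arr 5 = σ.arr 5 := run_arr (by decide)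
  have a8 : σ'.arr 8 = E := (run_arr (by decide)).trans hE
  have a1 : ∀ j, σ'.arr 1 j = if j = 0 then 1 else 0 := fun j => by
    simp [hσ', run, State.setArr_arr, Exp.eval, h1]
  clear_value σ'
  have key := run_iter_induction (b := 2) (x := 4) (σ := σ') (c := signColumn)
    (fun w τ => Signed a N w 0 E (τ.arr 1))
    ⟨by simp [a1], fun j => by simp only [State.setVar_arr, a1]; split_ifs <;> simp,
      by simp [a1], by simp⟩
    (fun w hw τ hk hv ha ih => by
      rw [hN'] at hw
      exact run_signColumn ((hv 2 (by decide)).trans hN') hk hw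
        (by rw [ha 5 (by decide), a5]; exact hT) (by rw [ha 0 (by decide), a0]; exact hA)
        ((ha 8 (by decide)).trans a8) hind ih)
  rw [hN'] at key
  exact ⟨(run_var (by decide)).trans v1, key⟩

theorem run_writeAnswer_of_eq {σ : State} (h3 : σ.var 3 = 0) :
    (writeAnswer.run 2 σ).var 1 = 1 ∧ (writeAnswer.run 2 σ).arr = σ.arr := by
  rw [writeAnswer, run, if_pos (by simpa [Exp.eval] using h3)]
  simp [run, State.setVar_var, Exp.eval]

end Cmd

end RAM

/-! ### Encodings and the adjacency matrix -/

theorem Polynomial.eval_nat_mono (p : Polynomial ℕ) {m n : ℕ} (h : m ≤ n) :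
    p.eval m ≤ p.eval n := by
  rw [Polynomial.eval_eq_sum_range, Polynomial.eval_eq_sum_range]
  gcongr

theorem length_rowMajor {n : ℕ} (b : Fin n → Fin n → Bool) : (rowMajor b).length = n * n := by
  simp [rowMajor]

theorem getElem_rowMajor {n : ℕ} (b : Fin n → Fin n → Bool) (x y : Fin n)
    (h : (x : ℕ) * n + y < (rowMajor b).length) : (rowMajor b)[(x : ℕ) * n + y] = b x y := by
  have hn : 0 < n := x.pos
  simp only [rowMajor, List.getElem_ofFn]
  congr 1
  · ext
    simp [Fin.divNat, mul_comm _ n, Nat.mul_add_div hn]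
  · ext
    simp [Fin.modNat, Nat.mod_eq_of_lt]

theorem exists_eq_mul_add_of_lt_mul_self {n k : ℕ} (hk : k < n * n) :
    ∃ x y : Fin n, k = (x : ℕ) * n + y := by
  have hn : 0 < n := Nat.pos_of_ne_zero fun h => by simp [h] at hk
  exact ⟨⟨k / n, Nat.div_lt_of_lt_mul hk⟩, ⟨k % n, Nat.mod_lt _ hn⟩, by
    simp [Nat.div_add_mod']⟩

/-- The entries of the adjacency matrix, continued by `0`. -/
def adjBit {n : ℕ} (G : SimpleGraph (Fin n)) [DecidableRel G.Adj] (x y : ℕ) : ℕ :=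
  if h : x < n ∧ y < n then (decide (G.Adj ⟨x, h.1⟩ ⟨y, h.2⟩)).toNat else 0

section adjBit

variable {n : ℕ} (G : SimpleGraph (Fin n)) [DecidableRel G.Adj]

theorem adjBit_val (x y : Fin n) : adjBit G x y = if G.Adj x y then 1 else 0 := by
  simp only [adjBit, x.2, y.2, and_self, dif_pos, Fin.eta]
  split_ifs <;> simp [*]

theorem adjBit_le (x y : ℕ) : adjBit G x y ≤ 1 := by
  rw [adjBit]
  split_ifs
  · exact Bool.toNat_le _
  · exact zero_le_one

theorem init_encodeGraph_arr {x y : ℕ} (hx : x < n) (hy : y < n) :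
    (RAM.State.init (encodeGraph G)).arr 0 (x * n + y) = adjBit G x y := by
  have hlt : x * n + y < (encodeGraph G).length := by
    rw [encodeGraph, length_rowMajor]
    nlinarith
  simp only [RAM.State.init, if_true, List.getD_eq_getElem _ _ hlt, adjBit, hx, hy, and_self,
    dif_pos]
  exact congrArg Bool.toNat (getElem_rowMajor _ ⟨x, hx⟩ ⟨y, hy⟩ _)

theorem exists_adjBit_coloring (hG : G.IsBipartite) :
    ∃ f : ℕ → Bool, ∀ x y, adjBit G x y ≠ 0 → f y ≠ f x := by
  obtain ⟨C⟩ := hG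
  refine ⟨fun x => if h : x < n then decide (C ⟨x, h⟩ = 0) else true, fun x y h => ?_⟩
  by_cases hxy : x < n ∧ y < n
  · rw [adjBit, dif_pos hxy] at h
    have hadj : G.Adj ⟨x, hxy.1⟩ ⟨y, hxy.2⟩ := by simpa using h
    have hne := C.valid hadj
    simp only [hxy.1, hxy.2, dif_pos]
    revert hne
    generalize C ⟨x, hxy.1⟩ = c
    generalize C ⟨y, hxy.2⟩ = d
    revert c d
    decide
  · exact absurd (by rw [adjBit, dif_neg hxy]) h

/-! ### From parity to real determinants -/

/-- If the adjacency matrix is invertible modulo `2`, then all its signings are invertible. -/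
theorem det_signedMatrix_ne_zero
    (h : (Matrix.of fun i j : Fin n => (adjBit G i j : ZMod 2)).det ≠ 0) (s : Signing n) :
    (signedMatrix (G.adjMatrix ℝ) s).det ≠ 0 := by
  -- The integer signed matrix maps to the real one and, as signs vanish modulo `2`, to the unsigned
  -- adjacency matrix over `ZMod 2`.
  set M : Matrix (Fin n) (Fin n) ℤ := Matrix.of fun i j => (adjBit G i j : ℤ) * (s i j : ℤ) with hM
  have h1 : signedMatrix (G.adjMatrix ℝ) s = (Int.castRingHom ℝ).mapMatrix M := by
    ext i j
    simp [signedMatrix, hM, SimpleGraph.adjMatrix_apply, adjBit_val]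
  have h2 : (Matrix.of fun i j : Fin n => (adjBit G i j : ZMod 2)) =
      (Int.castRingHom (ZMod 2)).mapMatrix M := by
    ext i j
    rcases Int.units_eq_one_or (s i j) with hs | hs <;> simp [hM, hs]
  rw [h2, ← RingHom.map_det] at h
  rw [h1, ← RingHom.map_det]
  intro h0
  refine h ?_
  rw [eq_intCast, Int.cast_eq_zero] at h0
  rw [h0, map_zero]

/-- Alternating signs along the selected entries of each column make the selected rows add up
to `0`. -/
theorem det_signedMatrix_eq_zero {f : ℕ → Bool} {E : ℕ → ℕ} {i : ℕ} (hi : i < n)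
    (hE : RowCombination f (adjBit G) n i (fun _ => 0) E) (s : Signing n)
    (hs : ∀ x y : Fin n, E x ≠ 0 → G.Adj x y →
      ((s x y : ℤ) = 2 * alternatingBit (adjBit G) E x y - 1)) :
    (signedMatrix (G.adjMatrix ℝ) s).det = 0 := by
  -- The indicator vector of the selected rows is a left kernel vector, nonzero because row `i` is
  -- selected.
  rw [← Matrix.exists_vecMul_eq_zero_iff]
  refine ⟨fun x => E x, fun h => ?_, ?_⟩
  · have := congrFun h ⟨i, hi⟩
    simp [hE.coeff_self] at this
  · ext y
    have h1 := sum_alternatingBit (adjBit G) E n y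
    rw [hE.alternatingBit_eq_zero (fun x _ => adjBit_le G x y) y.2, Finset.sum_range] at h1
    have h2 := congrArg (Int.cast : ℤ → ℝ) h1
    simp only [Nat.cast_zero, neg_zero, Int.cast_zero, Int.cast_sum] at h2
    rw [Pi.zero_apply, ← h2]
    simp only [Matrix.vecMul, dotProduct]
    refine Finset.sum_congr rfl fun x _ => ?_
    simp only [signedMatrix, Matrix.of_apply, SimpleGraph.adjMatrix_apply, adjBit_val]
    have hle := hE.coeff_le x x.2
    by_cases hx : E x = 0
    · simp [hx]
    · have hx1 : E x = 1 := by omega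
      by_cases hadj : G.Adj x y
      · rw [hs x y hx hadj]
        simp [hx1, hadj]
      · simp [hadj]

end adjBit

/-- The answer that consists of the bits `o 1`, `o 2`, … -/
def signingOfBits (n : ℕ) (o : ℕ → ℕ) : Signing n :=
  Matrix.of fun i j => if o (i * n + j + 1) = 1 then 1 else -1

theorem RAM.State.presents_some {n : ℕ} {τ : RAM.State} (h1 : τ.var 1 = n * n + 1)
    (h0 : τ.arr 1 0 = 1) (hle : ∀ j, τ.arr 1 j ≤ 1) :
    τ.Presents (encodeAnswer (some (signingOfBits n (τ.arr 1)))) := by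
  refine ⟨by simp [encodeAnswer, length_rowMajor, h1], fun k hk => ?_⟩
  cases k with
  | zero => simpa [encodeAnswer] using h0
  | succ k =>
    simp only [encodeAnswer, List.length_cons, length_rowMajor, add_lt_add_iff_right] at hk
    obtain ⟨x, y, rfl⟩ := exists_eq_mul_add_of_lt_mul_self hk
    simp only [encodeAnswer, List.getElem_cons_succ, getElem_rowMajor, signingOfBits,
      Matrix.of_apply]
    have := hle (x * n + y + 1)
    have hneg : (-1 : ℤˣ) ≠ 1 := by decide
    split_ifs with h
    · simp [h]
    · simp only [hneg, decide_false, Bool.toNat_false]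
      omega

/-! ### The complete algorithm -/

namespace RAM.Cmd

/-- The second stage of the program. -/
def solve : Cmd := seq tableCmd (seq eliminate writeAnswer)

theorem run_solve {n : ℕ} (G : SimpleGraph (Fin n)) [DecidableRel G.Adj] (hG : G.IsBipartite)
    {σ : State} (h0 : σ.var 0 = n * n) (h2 : σ.var 2 = n) (h3 : σ.var 3 = 0)
    (hσ : σ.arr = (State.init (encodeGraph G)).arr) :
    ∃ answer : Option (Signing n), (solve.run 2 σ).Presents (encodeAnswer answer) ∧
      (∀ s : Signing n, answer = some s →
        s.IsSymm ∧ (signedMatrix (G.adjMatrix ℝ) s).det = 0) ∧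
      (answer = none →
        ∀ s : Signing n, s.IsSymm → (signedMatrix (G.adjMatrix ℝ) s).det ≠ 0) := by
  obtain ⟨f, hf⟩ := exists_adjBit_coloring G hG
  have hzero : ∀ a ≠ 0, ∀ j, σ.arr a j = 0 := fun a ha j => by
    rw [hσ]; simp [State.init, ha]
  rw [solve, run, run]
  have hT := run_tableCmd σ
  rw [h2] at hT
  set σ₁ := tableCmd.run 2 σ with hσ₁
  have v0 : σ₁.var 0 = n * n := (run_var (by decide)).trans h0
  have v2 : σ₁.var 2 = n := (run_var (by decide)).trans h2
  have v3 : σ₁.var 3 = 0 := (run_var (by decide)).trans h3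
  have hA : ∀ x < n, ∀ y < n, σ₁.arr 0 (x * n + y) = adjBit G x y := fun x hx y hy => by
    rw [hσ₁, run_arr (by decide), hσ, init_encodeGraph_arr G hx hy]
  have a1 : ∀ j, σ₁.arr 1 j = 0 := fun j => by
    rw [hσ₁, run_arr (by decide), hzero 1 (by decide)]
  have he := run_eliminate v2 hT hA (fun x _ y _ => adjBit_le G x y) (fun x _ y _ => hf x y)
    (fun j => by rw [hσ₁, run_arr (by decide), hzero 2 (by decide)])
    (fun j => by rw [hσ₁, run_arr (by decide), hzero 4 (by decide)]) v3
  clear_value σ₁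
  set σ₂ := eliminate.run 2 σ₁ with hσ₂
  have w0 : σ₂.var 0 = n * n := (run_var (by decide)).trans v0
  have w2 : σ₂.var 2 = n := (run_var (by decide)).trans v2
  have b0 : σ₂.arr 0 = σ₁.arr 0 := run_arr (by decide)
  have b1 : σ₂.arr 1 = σ₁.arr 1 := run_arr (by decide)
  have b5 : σ₂.arr 5 = σ₁.arr 5 := run_arr (by decide)
  clear_value σ₂
  by_cases hdep : σ₂.var 3 = 0
  · obtain ⟨z1, z2⟩ := run_writeAnswer_of_eq hdep
    refine ⟨none, ⟨by simp [encodeAnswer, z1], fun k hk => ?_⟩, by simp, fun _ s _ => ?_⟩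
    -- The single output bit `0` need not be written: array `1` is still in its initial state.
    · simp [encodeAnswer, z2, b1, a1]
    · refine det_signedMatrix_ne_zero G ?_ s
      exact det_ne_zero_of_rowCombination he.rows he.pivot_lt (he.independent hdep)
        fun k k' hk hk' => he.triangular k k' hk hk' (he.independent hdep k (hk.trans hk'))
  · obtain ⟨i, hi, hE⟩ := he.dependent hdep
    -- Selected indices all have the colour of `i`, whereas adjacent vertices have different
    -- colours.
    have hind : ∀ x < n, ∀ y < n, σ₂.arr 8 x ≠ 0 → adjBit G x y ≠ 0 → σ₂.arr 8 y = 0 := by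
      intro x hx y hy hEx hxy
      by_contra hEy
      exact hf x y hxy ((hE.color_coeff y hy hEy).trans (hE.color_coeff x hx hEx).symm)
    obtain ⟨z1, z2⟩ := run_writeAnswer w2 (by rwa [b5]) (by rwa [b0]) rfl hind
      (fun j => by rw [b1, a1]) hdep
    set τ := writeAnswer.run 2 σ₂
    refine ⟨some (signingOfBits n (τ.arr 1)), State.presents_some (by rw [z1, w0]) z2.head z2.le,
      ?_, by simp⟩
    rintro s hs
    obtain rfl := Option.some.inj hs
    refine ⟨?_, det_signedMatrix_eq_zero G hi hE _ fun x y hEx hadj => ?_⟩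
    · ext x y
      simp only [Matrix.transpose_apply, signingOfBits, Matrix.of_apply]
      rw [z2.symm y y.2 x x.2]
    · have halt := z2.alternating x x.2 y y.2 hEx (by simp [adjBit_val, hadj]) (.inl y.2)
      have hle := z2.le (x * n + y + 1)
      rw [← halt]
      simp only [signingOfBits, Matrix.of_apply]
      split_ifs with h
      · simp [h]
      · have : τ.arr 1 (x * n + y + 1) = 0 := by omega
        simp [this]

end RAM.Cmd

theorem theorem2 :
    ∃ (P : RAM.Prog) (p : Polynomial ℕ),
      ∀ (n : ℕ) (G : SimpleGraph (Fin n)) [DecidableRel G.Adj], G.IsBipartite →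
        ∃ answer : Option (Signing n),
          P.OutputsWithin (encodeGraph G) (encodeAnswer answer)
            (p.eval (encodeGraph G).length) ∧
          (∀ s : Signing n, answer = some s →
            s.IsSymm ∧ (signedMatrix (G.adjMatrix ℝ) s).det = 0) ∧
          (answer = none →
            ∀ s : Signing n, s.IsSymm → (signedMatrix (G.adjMatrix ℝ) s).det ≠ 0) := by
  -- The two stages have different bounding registers: the input length `n * n` in register `0`, and
  -- then `n`, which the first stage leaves in register `2`.
  refine ⟨.seq (RAM.Cmd.sqrtCmd.compile 0) (RAM.Cmd.solve.compile 2),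
    RAM.Cmd.sqrtCmd.time + RAM.Cmd.solve.time, fun n G _ hG => ?_⟩
  have hlen : (encodeGraph G).length = n * n := length_rowMajor _
  set σ := RAM.State.init (encodeGraph G) with hσ
  have h0 : σ.var 0 = n * n := by simp [hσ, RAM.State.init, hlen]
  obtain ⟨t, ht, hexec⟩ := RAM.Cmd.exec_compile (b := 0) (c := RAM.Cmd.sqrtCmd) (σ := σ)
    (by simp [RAM.Cmd.sqrtCmd, RAM.Cmd.WellFormed, RAM.Cmd.vars]) (by decide)
  have h2 := RAM.Cmd.run_sqrtCmd h0 rfl rfl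
  set σ' := RAM.Cmd.sqrtCmd.run 0 σ with hσ'
  have h0' : σ'.var 0 = n * n := (RAM.Cmd.run_var (by decide)).trans h0
  have h3' : σ'.var 3 = 0 := RAM.Cmd.run_var (by decide)
  have harr : σ'.arr = σ.arr := funext fun a => RAM.Cmd.run_arr (by simp [RAM.Cmd.sqrtCmd,
    RAM.Cmd.arrs])
  clear_value σ'
  obtain ⟨u, hu, hexec'⟩ := RAM.Cmd.exec_compile (b := 2) (c := RAM.Cmd.solve) (σ := σ')
    (by simp [RAM.Cmd.solve, RAM.Cmd.tableCmd, RAM.Cmd.eliminate, RAM.Cmd.writeAnswer,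
      RAM.Cmd.rowInit, RAM.Cmd.rowReduce, RAM.Cmd.rowAdd, RAM.Cmd.rowSave, RAM.Cmd.recordCmd,
      RAM.Cmd.signColumn, RAM.Cmd.signEntry, RAM.Cmd.WellFormed, RAM.Cmd.vars]) (by decide)
  obtain ⟨answer, hout, hans⟩ := RAM.Cmd.run_solve G hG h0' h2 h3' harr
  refine ⟨answer, ⟨_, t + u, hexec.seq hexec', ?_, hout⟩, hans⟩
  rw [h0] at ht
  rw [h2] at hu
  rw [hlen, Polynomial.eval_add]
  -- The second time bound is a polynomial in `n`; it is evaluated at the length `n * n ≥ n`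
  -- instead.
  exact add_le_add ht (hu.trans (Polynomial.eval_nat_mono _ (Nat.le_mul_self n)))
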